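/- Let $n\ge 1$, let $\mathcal X$ be a measurable space, let $\mathbf X=(X_1,\dots,X_n)$ be a vector of independent (not necessarily identically distributed) random variables with values in $\mathcal X$, and let $f:\mathcal X^n\to\mathbb R$ be bounded and measurable. For $1\le k\le n$ and $y,y'\in\mathcal X$ put $$D^k_{y,y'}f(\mathbf x)=f(x_1,\dots,x_{k-1},y,x_{k+1},\dots,x_n)-f(x_1,\dots,x_{k-1},y',x_{k+1},\dots,x_n),$$ and define $$M(f)=\max_{k}\ \sup_{\mathbf x\in\mathcal X^n,\;y,y'\in\mathcal X}D^k_{y,y'}f(\mathbf x),\qquad J(f)=n\max_{l,k:\,l\ne k}\ \sup_{\mathbf x\in\mathcal X^n,\;z,z',y,y'\in\mathcal X}D^l_{z,z'}D^k_{y,y'}f(\mathbf x),$$ with $J(f)=0$ if $n=1$. For a real random variable $W$ with mean $E[W]$ and standard deviation $\sigma(W)>0$ let $$d_{\mathcal N}(W)=\sup\left\{\left|E\left[h\left(\frac{W-E[W]}{\sigma(W)}\right)\right]-E[h(Z)]\right| : h:\mathbb R\to\mathbb R\ \text{Lipschitz with constant } 1\right\},\qquad Z\sim\mathcal N(0,1),$$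 be the Wasserstein distance between the standardized $W$ and a standard normal variable. Let $\sigma^2(f)$ be the variance of $f(\mathbf X)$ and suppose that $\sigma^2(f)>0$. Then $$d_{\mathcal N}(f(\mathbf X))\le\frac{\sqrt n\,M(f)\,(J(f)+M(f))}{\sigma^2(f)}+\frac{n\,M(f)^3}{2\,\sigma^3(f)}.$$ -/

import Mathlib

open MeasureTheory ProbabilityTheory
open scoped NNReal ENNReal

noncomputable section

namespace WeakInteraction

/-- The partial difference operator: `partialDiff k y y' f x` is
`f (x₁, …, xₖ₋₁, y, xₖ₊₁, …, xₙ) - f (x₁, …, xₖ₋₁, y', xₖ₊₁, …, xₙ)`. -/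
def partialDiff {𝒳 : Type*} {n : ℕ} (k : Fin n) (y y' : 𝒳) (f : (Fin n → 𝒳) → ℝ) :
    (Fin n → 𝒳) → ℝ :=
  fun x => f (Function.update x k y) - f (Function.update x k y')

/-- The seminorm `M f`: the maximum over `k` of the supremum of all first partial differences
of `f` in the variable `k`. -/
def M {𝒳 : Type*} {n : ℕ} (f : (Fin n → 𝒳) → ℝ) : ℝ :=
  ⨆ k : Fin n, sSup {r : ℝ | ∃ (x : Fin n → 𝒳) (y y' : 𝒳), r = partialDiff k y y' f x}

/-- The seminorm `J f`: `n` times the maximum over `l ≠ k` of the supremum of all mixed second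
partial differences of `f` in the variables `l` and `k` (it is `0` if there is no such pair,
that is, if `n ≤ 1`). -/
def J {𝒳 : Type*} {n : ℕ} (f : (Fin n → 𝒳) → ℝ) : ℝ :=
  n * ⨆ p : {p : Fin n × Fin n // p.1 ≠ p.2},
    sSup {r : ℝ | ∃ (x : Fin n → 𝒳) (z z' y y' : 𝒳),
      r = partialDiff p.1.1 z z' (partialDiff p.1.2 y y' f) x}

/-- The distance to normality of a real random variable `W`: the Wasserstein distance between
`(W - E W) / σ(W)` and a standard normal variable, as a supremum over all real functions with
Lipschitz constant `1`. The supremum is taken in `[0, ∞]`, so that it always exists. -/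
def distNormal {Ω : Type*} [MeasurableSpace Ω] (P : Measure Ω) (W : Ω → ℝ) : ℝ≥0∞ :=
  ⨆ (h : ℝ → ℝ) (_ : LipschitzWith 1 h),
    ENNReal.ofReal |(∫ ω, h ((W ω - ∫ ω', W ω' ∂P) / √(variance W P)) ∂P)
      - ∫ z, h z ∂(gaussianReal 0 1)|

end WeakInteraction

end

/-!
The proof is Chatterjee's version of Stein's method, with a fixed order of the coordinates.
Let `g` be the standardization of `f`, a function of a sample `x` with `|∂ g| ≤ a = M f / σ` and
`|∂∂ g| ≤ b` with `n b = J f / σ`, and let `x'` be an independent copy of `x`.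

*Stein's equation.* For a `1`-Lipschitz function `h` with Gaussian mean `m` let `φ` solve
`φ' - x φ = h - m`, so that `E h(g) - m = E [φ'(g)] - E [g φ(g)]`. Comparison of `φ` times the
normal density with functions whose derivatives are explicit gives `|φ| ≤ 1`, `|φ'| ≤ √2` and
`|x φ'| ≤ 2`. Hence `φ' - h` is `3`-Lipschitz and `φ'` is `4`-Lipschitz, without any smoothness
of `h` (`IsSteinSolution.abs_deriv_le_sqrt_two`, `IsSteinSolution.abs_deriv_sub_le`).

*Approximate integration by parts.* As `g` is centred, `E [F(g) g] = E [F(g(x)) (g(x) - g(x'))]`,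
and `g(x) - g(x')` telescopes when the coordinates of `x` are replaced by those of `x'` one at a
time. The `i`-th term is antisymmetric under the exchange of the `i`-th coordinates of `x` and
`x'`. Symmetrizing, and applying the trapezoidal rule to `F`, turns the sum into `E [F'(g) T]`,
where `T` is half the sum of products of two partial differences of `g` (`steinCoeff`), with an
error of at most `n a³ / 2` for `F = φ` (`abs_integral_comp_mul_sub_le`). For `F = id` there is
no error, so `E T = 1`.

*Variance of the coefficient.* It remains to bound `E |φ'(g) (1 - τ)|`, where `τ` is the
conditional expectation of `T` given `x`. Changing one coordinate changes `τ` by at most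
`c = a (n b + a)` (`abs_partialDiff_condSteinCoeff_le`), and the same telescoping gives
`Var τ ≤ n c² / 2` (`variance_le_of_partialDiff`). So this term is at most
`√2 √(n / 2) c = √n c`.
-/

open Filter Topology

namespace SteinNormal

/-! ### The standard normal density -/

/-- The density of the standard normal distribution. -/
noncomputable def normalDensity (x : ℝ) : ℝ := gaussianPDFReal 0 1 x

lemma normalDensity_pos (x : ℝ) : 0 < normalDensity x :=
  gaussianPDFReal_pos 0 1 x one_ne_zero

lemma hasDerivAt_normalDensity (x : ℝ) : HasDerivAt normalDensity (-x * normalDensity x) x := by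
  have h1 : HasDerivAt (fun y : ℝ => -(y - 0) ^ 2 / (2 * ((1 : ℝ≥0) : ℝ))) (-x) x := by
    have h := (((hasDerivAt_id x).sub_const 0).pow 2).neg.div_const (2 * ((1 : ℝ≥0) : ℝ))
    refine h.congr_deriv ?_
    simp
    ring
  have h2 := h1.exp.const_mul (√(2 * Real.pi * ((1 : ℝ≥0) : ℝ)))⁻¹
  refine h2.congr_deriv ?_
  simp only [normalDensity, gaussianPDFReal]
  ring

lemma tendsto_normalDensity_cocompact : Tendsto normalDensity (cocompact ℝ) (𝓝 0) := by
  have h := (tendsto_rpow_abs_mul_exp_neg_mul_sq_cocompact (a := 1 / 2) (by norm_num) 0).const_mul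
    (√(2 * Real.pi * ((1 : ℝ≥0) : ℝ)))⁻¹
  rw [mul_zero] at h
  refine h.congr fun x => ?_
  simp only [normalDensity, gaussianPDFReal, Real.rpow_zero, one_mul]
  congr 2
  push_cast
  ring

lemma tendsto_normalDensity_atTop : Tendsto normalDensity atTop (𝓝 0) :=
  tendsto_normalDensity_cocompact.mono_left atTop_le_cocompact

lemma tendsto_normalDensity_atBot : Tendsto normalDensity atBot (𝓝 0) :=
  tendsto_normalDensity_cocompact.mono_left atBot_le_cocompact

lemma normalDensity_neg (x : ℝ) : normalDensity (-x) = normalDensity x := by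
  simp [normalDensity, gaussianPDFReal]

/-! ### Lipschitz functions under the standard normal distribution -/

lemma abs_sub_le_of_lipschitz {h : ℝ → ℝ} (hh : LipschitzWith 1 h) (x y : ℝ) :
    |h x - h y| ≤ |x - y| := by
  simpa [Real.dist_eq] using hh.dist_le_mul x y

lemma integrable_id_gaussian : Integrable (fun x : ℝ => x) (gaussianReal 0 1) :=
  (memLp_id_gaussianReal 1).integrable (by simp)

lemma integrable_sq_gaussian : Integrable (fun x : ℝ => x ^ 2) (gaussianReal 0 1) :=
  (memLp_id_gaussianReal 2).integrable_sq

lemma integral_sq_gaussian : ∫ x, x ^ 2 ∂(gaussianReal 0 1) = 1 := by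
  have h := variance_eq_sub (memLp_id_gaussianReal (μ := 0) (v := 1) 2)
  rw [variance_id_gaussianReal] at h
  simpa [integral_id_gaussianReal] using h.symm

lemma integrable_lipschitz_gaussian {h : ℝ → ℝ} (hh : LipschitzWith 1 h) :
    Integrable h (gaussianReal 0 1) := by
  refine Integrable.mono' ((integrable_const |h 0|).add integrable_id_gaussian.abs)
    hh.continuous.aestronglyMeasurable (ae_of_all _ fun x => ?_)
  have h1 := abs_sub_le_of_lipschitz hh x 0
  have h2 := abs_sub_abs_le_abs_sub (h x) (h 0)
  simp only [sub_zero, Real.norm_eq_abs, Pi.add_apply] at *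
  linarith

/-- A `1`-Lipschitz function is within `E |x - Z| ≤ √(1 + x²)` of its Gaussian mean. -/
lemma abs_sub_integral_gaussian_le {h : ℝ → ℝ} (hh : LipschitzWith 1 h) (x : ℝ) :
    |h x - ∫ z, h z ∂(gaussianReal 0 1)| ≤ √(1 + x ^ 2) := by
  have hi := integrable_lipschitz_gaussian hh
  have h1 : h x - ∫ z, h z ∂(gaussianReal 0 1) = ∫ z, (h x - h z) ∂(gaussianReal 0 1) := by
    rw [integral_sub (integrable_const _) hi]; simp
  have hq : ∫ z, ((x - z) ^ 2) ∂(gaussianReal 0 1) = 1 + x ^ 2 := by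
    have : ∀ z : ℝ, (x - z) ^ 2 = (x ^ 2 - 2 * x * z) + z ^ 2 := fun z => by ring
    simp_rw [this]
    have hl : Integrable (fun z : ℝ => 2 * x * z) (gaussianReal 0 1) :=
      integrable_id_gaussian.const_mul _
    have hcl : Integrable (fun z : ℝ => x ^ 2 - 2 * x * z) (gaussianReal 0 1) :=
      (integrable_const _).sub hl
    rw [integral_add hcl integrable_sq_gaussian, integral_sub (integrable_const _) hl,
      integral_const_mul, integral_sq_gaussian, integral_id_gaussianReal]
    simp; ring
  have hqi : Integrable (fun z : ℝ => (x - z) ^ 2) (gaussianReal 0 1) := by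
    have : (fun z : ℝ => (x - z) ^ 2) = fun z => (x ^ 2 - 2 * x * z) + z ^ 2 := by
      funext z; ring
    rw [this]
    exact ((integrable_const _).sub (integrable_id_gaussian.const_mul _)).add
      integrable_sq_gaussian
  set s := √(1 + x ^ 2) with hs
  have hs0 : 0 < s := Real.sqrt_pos.2 (by positivity)
  have hs2 : s ^ 2 = 1 + x ^ 2 := Real.sq_sqrt (by positivity)
  rw [h1]
  refine abs_integral_le_integral_abs.trans ?_
  -- `|d| ≤ (d² / s + s) / 2` replaces the Cauchy-Schwarz inequality
  have h2 : ∫ z, |h x - h z| ∂(gaussianReal 0 1)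
      ≤ ∫ z, ((x - z) ^ 2 * (1 / (2 * s)) + s / 2) ∂(gaussianReal 0 1) := by
    refine integral_mono ((integrable_const _).sub hi).abs
      ((hqi.mul_const _).add (integrable_const _)) fun z => ?_
    refine (abs_sub_le_of_lipschitz hh x z).trans ?_
    rw [← sq_abs (x - z)]
    have : |x - z| ^ 2 * (1 / (2 * s)) + s / 2 - |x - z| = (|x - z| - s) ^ 2 / (2 * s) := by
      field_simp; ring
    have h0 : 0 ≤ (|x - z| - s) ^ 2 / (2 * s) := by positivity
    linarith
  refine h2.trans (le_of_eq ?_)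
  rw [integral_add (hqi.mul_const _) (integrable_const _), integral_mul_const, hq, ← hs2]
  simp
  field_simp
  ring

/-! ### Solutions of Stein's equation -/

/-- `φ` solves Stein's equation `φ' - x φ = h - c` on the real line, and it is the solution for
which the product of `φ` with the normal density vanishes at `±∞`. The conditions on `h` and `c`
are included, since they are stable under the same symmetries `neg` and `reflect`. -/
structure IsSteinSolution (h φ : ℝ → ℝ) (c : ℝ) : Prop where
  lip : LipschitzWith 1 h
  center : ∀ x, |h x - c| ≤ √(1 + x ^ 2)
  deriv : ∀ x, HasDerivAt φ (x * φ x + (h x - c)) x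
  tendsto_bot : Tendsto (fun x => normalDensity x * φ x) atBot (𝓝 0)
  tendsto_top : Tendsto (fun x => normalDensity x * φ x) atTop (𝓝 0)

namespace IsSteinSolution

variable {h φ : ℝ → ℝ} {c : ℝ}

lemma neg (H : IsSteinSolution h φ c) :
    IsSteinSolution (fun x => -h x) (fun x => -φ x) (-c) where
  lip := H.lip.neg
  center x := by
    rw [show -h x - -c = -(h x - c) by ring, abs_neg]; exact H.center x
  deriv x := (H.deriv x).neg.congr_deriv (by ring)
  tendsto_bot := by simpa using H.tendsto_bot.neg
  tendsto_top := by simpa using H.tendsto_top.neg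

lemma reflect (H : IsSteinSolution h φ c) :
    IsSteinSolution (fun x => h (-x)) (fun x => -φ (-x)) c where
  lip := by simpa [Function.comp_def] using H.lip.comp (LipschitzWith.id.neg)
  center x := by simpa using H.center (-x)
  deriv x := by
    have := ((H.deriv (-x)).comp x (hasDerivAt_neg x)).neg
    exact this.congr_deriv (by ring)
  tendsto_bot := by
    have := (H.tendsto_top.comp tendsto_neg_atBot_atTop).neg
    simpa [Function.comp_def, normalDensity_neg] using this
  tendsto_top := by
    have := (H.tendsto_bot.comp tendsto_neg_atTop_atBot).neg
    simpa [Function.comp_def, normalDensity_neg] using this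

lemma hasDerivAt_mul (H : IsSteinSolution h φ c) (x : ℝ) :
    HasDerivAt (fun x => normalDensity x * φ x) (normalDensity x * (h x - c)) x :=
  ((hasDerivAt_normalDensity x).mul (H.deriv x)).congr_deriv (by ring)

/-- The function `q = p (1 - φ)`, with `p` the normal density, vanishes at `±∞`, and `q' / p` is
antitone because `h` is `1`-Lipschitz. So `q` increases and then decreases, hence `q ≥ 0`. -/
lemma le_one (H : IsSteinSolution h φ c) (x : ℝ) : φ x ≤ 1 := by
  set q : ℝ → ℝ := fun t => normalDensity t - normalDensity t * φ t with hq
  have hd : ∀ t, HasDerivAt q (normalDensity t * (-t - (h t - c))) t := fun t =>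
    ((hasDerivAt_normalDensity t).sub (H.hasDerivAt_mul t)).congr_deriv (by ring)
  have hanti : ∀ s t, s ≤ t → -t - (h t - c) ≤ -s - (h s - c) := fun s t hst => by
    have := abs_sub_le_of_lipschitz H.lip s t
    rw [abs_sub_comm s t, abs_of_nonneg (sub_nonneg.2 hst)] at this
    linarith [le_abs_self (h s - h t)]
  have hcont : Continuous q := continuous_iff_continuousAt.2 fun t => (hd t).continuousAt
  have hq0 : 0 ≤ q x := by
    rcases le_total 0 (-x - (h x - c)) with h0 | h0
    · have hm : MonotoneOn q (Set.Iic x) := by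
        refine monotoneOn_of_deriv_nonneg (convex_Iic x) hcont.continuousOn
          (fun t _ => (hd t).differentiableAt.differentiableWithinAt) fun t ht => ?_
        rw [interior_Iic] at ht
        rw [(hd t).deriv]
        exact mul_nonneg (normalDensity_pos t).le (h0.trans (hanti t x ht.le))
      have hl : Tendsto q atBot (𝓝 0) := by
        simpa using tendsto_normalDensity_atBot.sub H.tendsto_bot
      exact le_of_tendsto hl ((eventually_le_atBot x).mono fun t ht =>
        hm ht (Set.mem_Iic.2 le_rfl) ht)
    · have hm : AntitoneOn q (Set.Ici x) := by
        refine antitoneOn_of_deriv_nonpos (convex_Ici x) hcont.continuousOn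
          (fun t _ => (hd t).differentiableAt.differentiableWithinAt) fun t ht => ?_
        rw [interior_Ici] at ht
        rw [(hd t).deriv]
        exact mul_nonpos_of_nonneg_of_nonpos (normalDensity_pos t).le
          ((hanti x t ht.le).trans h0)
      have hl : Tendsto q atTop (𝓝 0) := by
        simpa using tendsto_normalDensity_atTop.sub H.tendsto_top
      exact le_of_tendsto hl ((eventually_ge_atTop x).mono fun t ht =>
        hm (Set.mem_Ici.2 le_rfl) ht ht)
  have hp := normalDensity_pos x
  have : 0 ≤ normalDensity x * (1 - φ x) := by simpa [hq, mul_sub] using hq0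
  linarith [nonneg_of_mul_nonneg_right this hp]

lemma abs_le_one (H : IsSteinSolution h φ c) (x : ℝ) : |φ x| ≤ 1 :=
  abs_le.2 ⟨by linarith [H.neg.le_one x], H.le_one x⟩

/-- An upper bound for `φ' = x φ + h - c` on the positive half-line. With `A = h x - c + x` the
Lipschitz condition gives `h t - c ≥ A - t` for `t ≥ x`, and comparison with the
function `p t / (1 + t²)`, a lower bound for the Gaussian tail, gives
`φ x ≤ 1 - A x / (1 + x²)`. -/
lemma deriv_le (H : IsSteinSolution h φ c) {x : ℝ} (hx : 0 ≤ x) :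
    x * φ x + (h x - c) ≤ (x + √(1 + x ^ 2)) / (1 + x ^ 2) := by
  set A := h x - c + x with hA
  have hx2 : 0 < 1 + x ^ 2 := by positivity
  have hAle : A ≤ x + √(1 + x ^ 2) := by linarith [le_abs_self (h x - c), H.center x]
  rcases le_or_gt A 0 with hA0 | hA0
  · have h1 : x * φ x ≤ x * 1 := mul_le_mul_of_nonneg_left (H.le_one x) hx
    have h2 : 0 ≤ (x + √(1 + x ^ 2)) / (1 + x ^ 2) := by positivity
    linarith
  · set q : ℝ → ℝ := fun t => (normalDensity t - normalDensity t * φ t)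
      - A * (normalDensity t * (t / (1 + t ^ 2))) with hq
    have hpos : ∀ t : ℝ, (1 + t ^ 2) ≠ 0 := fun t => by positivity
    have hr : ∀ t : ℝ, HasDerivAt (fun t : ℝ => t / (1 + t ^ 2))
        ((1 - t ^ 2) / (1 + t ^ 2) ^ 2) t := fun t => by
      have := (hasDerivAt_id t).div (((hasDerivAt_id t).pow 2).const_add 1) (hpos t)
      refine this.congr_deriv ?_
      simp; ring
    have hd : ∀ t, HasDerivAt q (normalDensity t * ((-t - (h t - c) + A)
        - 2 * A / (1 + t ^ 2) ^ 2)) t := fun t => by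
      refine (((hasDerivAt_normalDensity t).sub (H.hasDerivAt_mul t)).sub
        (((hasDerivAt_normalDensity t).mul (hr t)).const_mul A)).congr_deriv ?_
      have := hpos t
      field_simp
      ring
    have hcont : Continuous q := continuous_iff_continuousAt.2 fun t => (hd t).continuousAt
    have hm : AntitoneOn q (Set.Ici x) := by
      refine antitoneOn_of_deriv_nonpos (convex_Ici x) hcont.continuousOn
        (fun t _ => (hd t).differentiableAt.differentiableWithinAt) fun t ht => ?_
      rw [interior_Ici] at ht
      rw [(hd t).deriv]
      refine mul_nonpos_of_nonneg_of_nonpos (normalDensity_pos t).le ?_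
      have h1 := abs_sub_le_of_lipschitz H.lip x t
      rw [abs_sub_comm x t, abs_of_nonneg (sub_nonneg.2 (Set.mem_Ioi.1 ht).le)] at h1
      have h2 : 0 ≤ 2 * A / (1 + t ^ 2) ^ 2 := by positivity
      linarith [le_abs_self (h x - h t)]
    have hl0 : Tendsto (fun t => normalDensity t * (t / (1 + t ^ 2))) atTop (𝓝 0) := by
      refine squeeze_zero_norm (fun t => ?_) tendsto_normalDensity_atTop
      rw [norm_mul, Real.norm_of_nonneg (normalDensity_pos t).le]
      refine mul_le_of_le_one_right (normalDensity_pos t).le ?_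
      rw [Real.norm_eq_abs, abs_div, abs_of_pos (show 0 < 1 + t ^ 2 by positivity),
        div_le_one (by positivity), ← sq_abs]
      nlinarith [sq_nonneg (|t| - 1), abs_nonneg t]
    have hl : Tendsto q atTop (𝓝 0) := by
      simpa using (tendsto_normalDensity_atTop.sub H.tendsto_top).sub (hl0.const_mul A)
    have hq0 : 0 ≤ q x := le_of_tendsto hl ((eventually_ge_atTop x).mono fun t ht =>
        hm (Set.mem_Ici.2 le_rfl) ht ht)
    have hφ : φ x ≤ 1 - A * (x / (1 + x ^ 2)) := by
      have : 0 ≤ normalDensity x * (1 - φ x - A * (x / (1 + x ^ 2))) := by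
        refine hq0.trans (le_of_eq ?_); simp only [hq]; ring
      linarith [nonneg_of_mul_nonneg_right this (normalDensity_pos x)]
    have h1 : x * φ x ≤ x * (1 - A * (x / (1 + x ^ 2))) := mul_le_mul_of_nonneg_left hφ hx
    have h2 : x * (1 - A * (x / (1 + x ^ 2))) + (h x - c) = A / (1 + x ^ 2) := by
      rw [show h x - c = A - x by rw [hA]; ring]; field_simp; ring
    calc x * φ x + (h x - c) ≤ A / (1 + x ^ 2) := by linarith
      _ ≤ _ := by gcongr

lemma abs_deriv_le (H : IsSteinSolution h φ c) (x : ℝ) :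
    |x * φ x + (h x - c)| ≤ (|x| + √(1 + x ^ 2)) / (1 + x ^ 2) := by
  have key : ∀ {h φ : ℝ → ℝ} {c : ℝ}, IsSteinSolution h φ c → ∀ {x : ℝ}, 0 ≤ x →
      |x * φ x + (h x - c)| ≤ (x + √(1 + x ^ 2)) / (1 + x ^ 2) := by
    intro h φ c H x hx
    refine abs_le.2 ⟨?_, H.deriv_le hx⟩
    have := H.neg.deriv_le hx
    linarith
  rcases le_total 0 x with hx | hx
  · rw [abs_of_nonneg hx]; exact key H hx
  · have := key H.reflect (neg_nonneg.2 hx)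
    rw [abs_of_nonpos hx]
    simpa using this

lemma abs_deriv_le_sqrt_two (H : IsSteinSolution h φ c) (x : ℝ) :
    |x * φ x + (h x - c)| ≤ √2 := by
  refine (H.abs_deriv_le x).trans ?_
  set s := √(1 + x ^ 2) with hs
  have hs2 : s ^ 2 = 1 + x ^ 2 := Real.sq_sqrt (by positivity)
  have hs1 : 1 ≤ s := Real.one_le_sqrt.2 (by nlinarith [sq_nonneg x])
  rw [← hs2]
  have hx : |x| ^ 2 = s ^ 2 - 1 := by rw [sq_abs, hs2]; ring
  -- at the maximum, where `s = 2 / √3` and `|x| = s / 2`, the square of the bound is `27 / 16`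
  refine Real.le_sqrt_of_sq_le ?_
  rw [div_pow, div_le_iff₀ (by positivity)]
  have h1 : (|x| + s) ^ 2 ≤ 4 * |x| ^ 2 + 4 / 3 * s ^ 2 := by
    nlinarith [sq_nonneg (3 * |x| - s)]
  nlinarith [sq_nonneg (s ^ 2 - 4 / 3), sq_nonneg (s ^ 2 - 1)]

lemma abs_mul_deriv_le_two (H : IsSteinSolution h φ c) (x : ℝ) :
    |x * (x * φ x + (h x - c))| ≤ 2 := by
  rw [abs_mul]
  refine (mul_le_mul_of_nonneg_left (H.abs_deriv_le x) (abs_nonneg x)).trans ?_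
  set s := √(1 + x ^ 2) with hs
  have hs2 : s ^ 2 = 1 + x ^ 2 := Real.sq_sqrt (by positivity)
  have hs0 : 0 < s := Real.sqrt_pos.2 (by positivity)
  have hx : |x| ^ 2 = s ^ 2 - 1 := by rw [sq_abs, hs2]; ring
  have hxs : |x| ≤ s := by nlinarith [abs_nonneg x]
  rw [← hs2, ← mul_div_assoc, div_le_iff₀ (by positivity)]
  nlinarith [abs_nonneg x]

/-- `φ' - h` has derivative `φ + x φ'`, which is bounded by `3`, so `φ'` is `4`-Lipschitz. -/
lemma abs_deriv_sub_le (H : IsSteinSolution h φ c) (x y : ℝ) :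
    |(x * φ x + (h x - c)) - (y * φ y + (h y - c))| ≤ 4 * |x - y| := by
  have hd : ∀ t, HasDerivAt (fun t => t * φ t) (φ t + t * (t * φ t + (h t - c))) t := fun t =>
    ((hasDerivAt_id t).mul (H.deriv t)).congr_deriv (by simp)
  have h3 := Convex.norm_image_sub_le_of_norm_hasDerivWithin_le (C := 3)
    (fun t _ => (hd t).hasDerivWithinAt) (fun t _ => by
      rw [Real.norm_eq_abs]
      refine (abs_add_le _ _).trans ?_
      linarith [H.abs_le_one t, H.abs_mul_deriv_le_two t]) convex_univ (Set.mem_univ y)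
      (Set.mem_univ x)
  rw [Real.norm_eq_abs, Real.norm_eq_abs] at h3
  have h1 := abs_sub_le_of_lipschitz H.lip x y
  calc _ = |(x * φ x - y * φ y) + (h x - h y)| := by congr 1; ring
    _ ≤ _ := (abs_add_le _ _).trans (by linarith)

end IsSteinSolution

/-! ### Existence of the solution -/

lemma exists_isSteinSolution {h : ℝ → ℝ} (hh : LipschitzWith 1 h) :
    ∃ φ, IsSteinSolution h φ (∫ z, h z ∂(gaussianReal 0 1)) := by
  set c := ∫ z, h z ∂(gaussianReal 0 1) with hc
  set k : ℝ → ℝ := fun t => normalDensity t * (h t - c) with hk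
  have hpc : Continuous normalDensity :=
    continuous_iff_continuousAt.2 fun t => (hasDerivAt_normalDensity t).continuousAt
  have hkc : Continuous k := hpc.mul (hh.continuous.sub continuous_const)
  have hgi : Integrable (fun t => h t - c) (gaussianReal 0 1) :=
    (integrable_lipschitz_gaussian hh).sub (integrable_const _)
  have hki : Integrable k := by
    rw [gaussianReal_of_var_ne_zero _ one_ne_zero, integrable_withDensity_iff_integrable_smul'
      (measurable_gaussianPDF _ _) (ae_of_all _ fun _ => ENNReal.ofReal_lt_top)] at hgi
    refine hgi.congr (ae_of_all _ fun t => ?_)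
    simp [hk, normalDensity, gaussianPDF, gaussianPDFReal_nonneg]
  have hk0 : ∫ t, k t = 0 := by
    have h1 := integral_gaussianReal_eq_integral_smul (μ := 0) (v := 1)
      (f := fun t => h t - c) one_ne_zero
    rw [integral_sub (integrable_lipschitz_gaussian hh) (integrable_const _)] at h1
    simpa [hk, normalDensity, hc] using h1.symm
  set Φ : ℝ → ℝ := fun x => (∫ t in Set.Iic 0, k t) + ∫ t in (0 : ℝ)..x, k t with hΦ
  have hΦd : ∀ x, HasDerivAt Φ (k x) x := fun x =>
    (intervalIntegral.integral_hasDerivAt_right (hkc.intervalIntegrable _ _)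
      (hkc.stronglyMeasurableAtFilter _ _) hkc.continuousAt).const_add _
  have hbot : Tendsto Φ atBot (𝓝 0) := by
    have := (intervalIntegral_tendsto_integral_Iic 0 hki.integrableOn tendsto_id).const_sub
      (∫ t in Set.Iic 0, k t)
    rw [sub_self] at this
    refine this.congr fun x => ?_
    simp only [hΦ, id, intervalIntegral.integral_symm 0 x]
    ring
  have htop : Tendsto Φ atTop (𝓝 0) := by
    have := (intervalIntegral_tendsto_integral_Ioi 0 hki.integrableOn tendsto_id).const_add
      (∫ t in Set.Iic 0, k t)
    rwa [intervalIntegral.integral_Iic_add_Ioi hki.integrableOn hki.integrableOn, hk0] at this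
  have hmul : (fun x => normalDensity x * (Φ x / normalDensity x)) = Φ := by
    funext x; rw [mul_div_cancel₀ _ (normalDensity_pos x).ne']
  refine ⟨fun x => Φ x / normalDensity x, hh, abs_sub_integral_gaussian_le hh, fun x => ?_,
    by rwa [hmul], by rwa [hmul]⟩
  have hp := (normalDensity_pos x).ne'
  refine ((hΦd x).div (hasDerivAt_normalDensity x) hp).congr_deriv ?_
  simp only [hk]
  field_simp
  ring

/-! ### The trapezoidal rule -/

/-- The error of the trapezoidal rule for a function whose derivative is Lipschitz. -/
lemma abs_trapezoid_le {F F' : ℝ → ℝ} {L : ℝ} (hF : ∀ x, HasDerivAt F (F' x) x)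
    (hL : ∀ x y, |F' x - F' y| ≤ L * |x - y|) (x y : ℝ) :
    |F x - F y - (x - y) * ((F' x + F' y) / 2)| ≤ L / 4 * (x - y) ^ 2 := by
  -- first-order expansion with quadratic remainder
  have key : ∀ a b, |F b - F a - (b - a) * F' a| ≤ L / 2 * (b - a) ^ 2 := by
    intro a b
    have hG : ∀ t ∈ Set.Icc (0 : ℝ) 1, HasDerivWithinAt
        (fun t => F (a + t * (b - a)) - F a - t * ((b - a) * F' a))
        ((F' (a + t * (b - a)) - F' a) * (b - a)) (Set.Icc 0 1) t := by
      intro t _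
      have h1 : HasDerivAt (fun t : ℝ => a + t * (b - a)) (b - a) t := by
        simpa using ((hasDerivAt_id t).mul_const (b - a)).const_add a
      have h2 := (((hF (a + t * (b - a))).comp t h1).sub_const (F a)).sub
        ((hasDerivAt_id t).mul_const ((b - a) * F' a))
      exact (h2.congr_deriv (by ring)).hasDerivWithinAt
    have hB : ∀ t : ℝ, HasDerivAt (fun t : ℝ => L / 2 * (b - a) ^ 2 * t ^ 2)
        (L * t * (b - a) ^ 2) t := fun t => by
      refine (((hasDerivAt_id t).pow 2).const_mul (L / 2 * (b - a) ^ 2)).congr_deriv ?_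
      simp; ring
    have := image_norm_le_of_norm_deriv_right_le_deriv_boundary (a := (0 : ℝ)) (b := 1)
      (fun t ht => (hG t ht).continuousWithinAt)
      (fun t ht => ((hG t (Set.Ico_subset_Icc_self ht)).mono_of_mem_nhdsWithin
        (Icc_mem_nhdsGE_of_mem ht)))
      (by simp) (fun t => hB t) (fun t ht => by
        rw [norm_mul, Real.norm_eq_abs, Real.norm_eq_abs]
        refine (mul_le_mul_of_nonneg_right (hL _ _) (abs_nonneg _)).trans (le_of_eq ?_)
        rw [add_sub_cancel_left, abs_mul, abs_of_nonneg ht.1, ← sq_abs (b - a)]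
        ring) (Set.right_mem_Icc.2 zero_le_one)
    simpa using this
  have h1 := key x ((x + y) / 2)
  have h2 := key y ((x + y) / 2)
  rw [abs_le] at *
  constructor <;> nlinarith

end SteinNormal

namespace WeakInteraction

variable {𝒳 : Type*} {n : ℕ}

/-! ### Interpolating between two samples -/

/-- The sample which agrees with `x'` in the coordinates below `s` and with `x` in the others. -/
def mix (s : ℕ) (x x' : Fin n → 𝒳) : Fin n → 𝒳 := fun k => if (k : ℕ) < s then x' k else x k

/-- Exchange of the `i`-th coordinates of two samples. -/
def swapAt (i : Fin n) (z : (Fin n → 𝒳) × (Fin n → 𝒳)) : (Fin n → 𝒳) × (Fin n → 𝒳) :=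
  (Function.update z.1 i (z.2 i), Function.update z.2 i (z.1 i))

/-- The change of `g` at the first sample when its `i`-th coordinate is replaced by that of the
second sample. -/
def coordDiff (g : (Fin n → 𝒳) → ℝ) (i : Fin n) (z : (Fin n → 𝒳) × (Fin n → 𝒳)) : ℝ :=
  g z.1 - g (Function.update z.1 i (z.2 i))

/-- The change of `g` in the `i`-th step of the interpolation from the first sample to the
second. -/
def stepDiff (g : (Fin n → 𝒳) → ℝ) (i : Fin n) (z : (Fin n → 𝒳) × (Fin n → 𝒳)) : ℝ :=
  g (mix i z.1 z.2) - g (mix (i + 1) z.1 z.2)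

lemma mix_swapAt (i : Fin n) (z : (Fin n → 𝒳) × (Fin n → 𝒳)) :
    mix i (swapAt i z).1 (swapAt i z).2 = mix (i + 1) z.1 z.2 := by
  funext k
  rcases lt_trichotomy (k : ℕ) i with h | h | h
  · have : k ≠ i := fun e => by simp [e] at h
    simp [mix, swapAt, h, Function.update_of_ne this, Nat.lt_succ_of_lt h]
  · obtain rfl := Fin.ext h
    simp [mix, swapAt]
  · have : k ≠ i := fun e => by simp [e] at h
    have h2 : ¬ (k : ℕ) < i + 1 := by omega
    simp [mix, swapAt, h.not_gt, Function.update_of_ne this, h2]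

lemma swapAt_swapAt (i : Fin n) (z : (Fin n → 𝒳) × (Fin n → 𝒳)) :
    swapAt i (swapAt i z) = z := by
  simp [swapAt]

lemma stepDiff_swapAt (g : (Fin n → 𝒳) → ℝ) (i : Fin n) (z : (Fin n → 𝒳) × (Fin n → 𝒳)) :
    stepDiff g i (swapAt i z) = -stepDiff g i z := by
  have h := mix_swapAt i (swapAt i z)
  rw [swapAt_swapAt] at h
  rw [stepDiff, stepDiff, mix_swapAt, ← h]
  ring

lemma coordDiff_swapAt (g : (Fin n → 𝒳) → ℝ) (i : Fin n) (z : (Fin n → 𝒳) × (Fin n → 𝒳)) :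
    coordDiff g i (swapAt i z) = -coordDiff g i z := by
  simp [coordDiff, swapAt]

lemma sum_stepDiff (g : (Fin n → 𝒳) → ℝ) (z : (Fin n → 𝒳) × (Fin n → 𝒳)) :
    ∑ i, stepDiff g i z = g z.1 - g z.2 := by
  have h0 : mix 0 z.1 z.2 = z.1 := by funext k; simp [mix]
  have hn : mix n z.1 z.2 = z.2 := by funext k; simp [mix]
  have := Finset.sum_range_sub' (fun s => g (mix s z.1 z.2)) n
  rw [h0, hn, Finset.sum_range] at this
  exact this

lemma coordDiff_eq_partialDiff (g : (Fin n → 𝒳) → ℝ) (i : Fin n)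
    (z : (Fin n → 𝒳) × (Fin n → 𝒳)) :
    coordDiff g i z = partialDiff i (z.1 i) (z.2 i) g z.1 := by
  simp [coordDiff, partialDiff]

lemma stepDiff_eq_partialDiff (g : (Fin n → 𝒳) → ℝ) (i : Fin n)
    (z : (Fin n → 𝒳) × (Fin n → 𝒳)) :
    stepDiff g i z = partialDiff i (z.1 i) (z.2 i) g (mix i z.1 z.2) := by
  have h1 : Function.update (mix i z.1 z.2) i (z.1 i) = mix i z.1 z.2 := by
    rw [Function.update_eq_self_iff]; simp [mix]
  have h2 : Function.update (mix i z.1 z.2) i (z.2 i) = mix (i + 1) z.1 z.2 := by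
    funext k
    by_cases h : k = i
    · subst h; simp [mix]
    · have hne : (k : ℕ) ≠ i := fun e => h (Fin.ext e)
      rw [Function.update_of_ne h]
      simp only [mix, Nat.lt_succ_iff_lt_or_eq, hne, or_false]
  rw [stepDiff, partialDiff, h1, h2]

lemma mix_update_of_lt {i j : Fin n} (h : i < j) (x x' : Fin n → 𝒳) (y : 𝒳) :
    mix j (Function.update x i y) x' = mix j x x' := by
  funext k
  by_cases hk : k = i
  · subst hk; simp [mix, Fin.lt_def.1 h]
  · simp [mix, Function.update_of_ne hk]

lemma mix_update_of_le {i j : Fin n} (h : j ≤ i) (x x' : Fin n → 𝒳) (y : 𝒳) :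
    mix j (Function.update x i y) x' = Function.update (mix j x x') i y := by
  funext k
  by_cases hk : k = i
  · subst hk; simp [mix, Fin.not_lt.2 h]
  · simp [mix, Function.update_of_ne hk]

lemma abs_coordDiff_le {g : (Fin n → 𝒳) → ℝ} {a : ℝ}
    (ha : ∀ i y y' x, |partialDiff i y y' g x| ≤ a) (i : Fin n)
    (z : (Fin n → 𝒳) × (Fin n → 𝒳)) : |coordDiff g i z| ≤ a := by
  rw [coordDiff_eq_partialDiff]; exact ha _ _ _ _

lemma abs_stepDiff_le {g : (Fin n → 𝒳) → ℝ} {a : ℝ}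
    (ha : ∀ i y y' x, |partialDiff i y y' g x| ≤ a) (i : Fin n)
    (z : (Fin n → 𝒳) × (Fin n → 𝒳)) : |stepDiff g i z| ≤ a := by
  rw [stepDiff_eq_partialDiff]; exact ha _ _ _ _

lemma abs_coordDiff_mul_stepDiff_le {g : (Fin n → 𝒳) → ℝ} {a : ℝ}
    (ha : ∀ i y y' x, |partialDiff i y y' g x| ≤ a) (i : Fin n)
    (z : (Fin n → 𝒳) × (Fin n → 𝒳)) :
    |1 / 2 * (coordDiff g i z * stepDiff g i z)| ≤ a ^ 2 / 2 := by
  have h := mul_le_mul (abs_coordDiff_le ha i z) (abs_stepDiff_le ha i z) (abs_nonneg _)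
    ((abs_nonneg _).trans (abs_coordDiff_le ha i z))
  rw [← abs_mul] at h
  rw [abs_mul, abs_of_pos (by norm_num : (0 : ℝ) < 1 / 2)]
  linarith

/-- Half the sum of the products of the coordinate differences and the interpolation
differences. It is a Stein coefficient up to an error: `E [F(g) g] ≈ E [F'(g) T]`. -/
noncomputable def steinCoeff (g : (Fin n → 𝒳) → ℝ) (z : (Fin n → 𝒳) × (Fin n → 𝒳)) : ℝ :=
  ∑ i, 1 / 2 * (coordDiff g i z * stepDiff g i z)

lemma abs_steinCoeff_le {g : (Fin n → 𝒳) → ℝ} {a : ℝ}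
    (ha : ∀ i y y' x, |partialDiff i y y' g x| ≤ a) (z : (Fin n → 𝒳) × (Fin n → 𝒳)) :
    |steinCoeff g z| ≤ n * (a ^ 2 / 2) := by
  refine (Finset.abs_sum_le_sum_abs _ _).trans ((Finset.sum_le_sum fun i _ =>
    abs_coordDiff_mul_stepDiff_le ha i z).trans (le_of_eq ?_))
  simp

/-! ### Exchangeability of two independent samples -/

section Measure

variable [MeasurableSpace 𝒳]

lemma measurable_mix (s : ℕ) :
    Measurable fun z : (Fin n → 𝒳) × (Fin n → 𝒳) => mix s z.1 z.2 := by
  refine measurable_pi_iff.2 fun k => ?_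
  by_cases h : (k : ℕ) < s <;> simp only [mix, h, if_true, if_false] <;> fun_prop

lemma measurable_update_fst (i : Fin n) :
    Measurable fun z : (Fin n → 𝒳) × (Fin n → 𝒳) => Function.update z.1 i (z.2 i) := by
  refine measurable_pi_iff.2 fun k => ?_
  by_cases h : k = i
  · subst h; simp only [Function.update_self]; fun_prop
  · simp only [Function.update_of_ne h]; fun_prop

lemma measurable_coordDiff {g : (Fin n → 𝒳) → ℝ} (hg : Measurable g) (i : Fin n) :
    Measurable (coordDiff g i) :=
  (hg.comp measurable_fst).sub (hg.comp (measurable_update_fst i))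

lemma measurable_stepDiff {g : (Fin n → 𝒳) → ℝ} (hg : Measurable g) (i : Fin n) :
    Measurable (stepDiff g i) :=
  (hg.comp (measurable_mix _)).sub (hg.comp (measurable_mix _))

lemma measurePreserving_swapAt (ν : Fin n → Measure 𝒳) [∀ i, IsProbabilityMeasure (ν i)]
    (i : Fin n) :
    MeasurePreserving (swapAt (𝒳 := 𝒳) i) ((Measure.pi ν).prod (Measure.pi ν))
      ((Measure.pi ν).prod (Measure.pi ν)) := by
  have he := measurePreserving_arrowProdEquivProdArrow 𝒳 𝒳 (Fin n) ν ν
  have hs : MeasurePreserving (fun (z : Fin n → 𝒳 × 𝒳) k => if k = i then (z k).swap else z k)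
      (Measure.pi fun k => (ν k).prod (ν k)) (Measure.pi fun k => (ν k).prod (ν k)) := by
    refine measurePreserving_pi (fun k => (ν k).prod (ν k)) (fun k => (ν k).prod (ν k))
      (f := fun k (p : 𝒳 × 𝒳) => if k = i then p.swap else p) fun k => ?_
    by_cases h : k = i
    · simp only [h, if_true]
      exact Measure.measurePreserving_swap (μ := ν i) (ν := ν i)
    · simp only [h, if_false]
      exact MeasurePreserving.id ((ν k).prod (ν k))
  have h := he.comp (hs.comp he.symm)
  convert! h using 1
  funext z
  refine Prod.ext (funext fun k => ?_) (funext fun k => ?_) <;>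
  · by_cases hk : k = i
    · subst hk
      simp [swapAt, MeasurableEquiv.arrowProdEquivProdArrow, Equiv.arrowProdEquivProdArrow]
    · simp [swapAt, MeasurableEquiv.arrowProdEquivProdArrow, Equiv.arrowProdEquivProdArrow, hk]

lemma integrable_of_abs_le {α : Type*} [MeasurableSpace α] {μ : Measure α} [IsFiniteMeasure μ]
    {F : α → ℝ} (hF : Measurable F) {C : ℝ} (hC : ∀ x, |F x| ≤ C) : Integrable F μ :=
  Integrable.of_bound hF.aestronglyMeasurable C (ae_of_all _ hC)

lemma abs_integral_le_of_abs_le {α : Type*} [MeasurableSpace α] {μ : Measure α}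
    [IsProbabilityMeasure μ] {F : α → ℝ} {C : ℝ} (hC : ∀ x, |F x| ≤ C) : |∫ x, F x ∂μ| ≤ C := by
  simpa using norm_integral_le_of_norm_le_const (μ := μ) (f := F) (ae_of_all _ hC)

variable (ν : Fin n → Measure 𝒳) [∀ i, IsProbabilityMeasure (ν i)]

/-- Symmetrization: the integrand may be averaged over the exchange of the `i`-th coordinates
of the two samples. -/
lemma abs_integral_le_of_swapAt (i : Fin n) {G : (Fin n → 𝒳) × (Fin n → 𝒳) → ℝ}
    (hG : Integrable G ((Measure.pi ν).prod (Measure.pi ν))) {C : ℝ}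
    (hC : ∀ z, |G z + G (swapAt i z)| ≤ C) :
    |∫ z, G z ∂((Measure.pi ν).prod (Measure.pi ν))| ≤ C / 2 := by
  set μ₂ := (Measure.pi ν).prod (Measure.pi ν) with hμ₂
  have hp := measurePreserving_swapAt ν i
  have hint : ∫ z, G (swapAt i z) ∂μ₂ = ∫ z, G z ∂μ₂ := by
    have h1 := integral_map (μ := μ₂) hp.measurable.aemeasurable
      (f := G) (by rw [hp.map_eq]; exact hG.aestronglyMeasurable)
    rw [hp.map_eq] at h1
    exact h1.symm
  have hadd : ∫ z, (G z + G (swapAt i z)) ∂μ₂ = 2 * ∫ z, G z ∂μ₂ := by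
    have hS : Integrable (fun z => G (swapAt i z)) μ₂ := hp.integrable_comp_of_integrable hG
    rw [integral_add hG hS, hint]; ring
  have hb := abs_integral_le_of_abs_le (μ := μ₂) hC
  rw [hadd, abs_mul, abs_two] at hb
  linarith

/-- The covariance of two functions of the sample, as a sum over the steps of the
interpolation. -/
lemma integral_mul_sub_eq_sum {u g : (Fin n → 𝒳) → ℝ} (hu : Measurable u) (hg : Measurable g)
    {Cu Cg : ℝ} (hCu : ∀ x, |u x| ≤ Cu) (hCg : ∀ x, |g x| ≤ Cg) :
    (∫ x, u x * g x ∂(Measure.pi ν)) - (∫ x, u x ∂(Measure.pi ν)) * ∫ x, g x ∂(Measure.pi ν) =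
      ∑ i, ∫ z, u z.1 * stepDiff g i z ∂((Measure.pi ν).prod (Measure.pi ν)) := by
  have hCu0 : ∀ x, 0 ≤ Cu := fun x => (abs_nonneg _).trans (hCu x)
  have hug : ∀ x y, |u x * g y| ≤ Cu * Cg := fun x y => by
    rw [abs_mul]; exact mul_le_mul (hCu x) (hCg y) (abs_nonneg _) (hCu0 x)
  have hstep : ∀ i z, u z.1 * stepDiff g i z
      = u z.1 * g (mix i z.1 z.2) - u z.1 * g (mix (i + 1) z.1 z.2) := fun i z => by
    rw [stepDiff]; ring
  rw [← integral_finsetSum]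
  · simp_rw [← Finset.mul_sum, sum_stepDiff, mul_sub]
    rw [integral_sub, integral_prod_mul]
    · congr 1
      have := integral_fun_fst (μ := Measure.pi ν) (ν := Measure.pi ν) (fun x => u x * g x)
      simpa using this.symm
    · exact integrable_of_abs_le ((hu.comp measurable_fst).mul (hg.comp measurable_fst))
        fun z => hug _ _
    · exact integrable_of_abs_le ((hu.comp measurable_fst).mul (hg.comp measurable_snd))
        fun z => hug _ _
  · intro i _
    simp_rw [hstep]
    exact (integrable_of_abs_le ((hu.comp measurable_fst).mul (hg.comp (measurable_mix _)))
        fun z => hug _ _).sub (integrable_of_abs_le ((hu.comp measurable_fst).mul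
          (hg.comp (measurable_mix _))) fun z => hug _ _)

/-- A weak form of the Efron-Stein inequality: the variance of a function of independent
variables whose partial differences are bounded by `c` is at most `n c² / 2`. -/
lemma variance_le_of_partialDiff {g : (Fin n → 𝒳) → ℝ} (hg : Measurable g) {C : ℝ}
    (hC : ∀ x, |g x| ≤ C) {c : ℝ} (hc : ∀ i y y' x, |partialDiff i y y' g x| ≤ c) :
    (∫ x, g x * g x ∂(Measure.pi ν)) - (∫ x, g x ∂(Measure.pi ν)) * ∫ x, g x ∂(Measure.pi ν)
      ≤ n * (c ^ 2 / 2) := by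
  rw [integral_mul_sub_eq_sum ν hg hg hC hC]
  have hterm : ∀ i ∈ Finset.univ,
      ∫ z, g z.1 * stepDiff g i z ∂((Measure.pi ν).prod (Measure.pi ν)) ≤ c ^ 2 / 2 := by
    intro i _
    refine (le_abs_self _).trans (abs_integral_le_of_swapAt ν i
      (G := fun z => g z.1 * stepDiff g i z)
      (integrable_of_abs_le (C := C * c) ((hg.comp measurable_fst).mul (measurable_stepDiff hg i))
        fun z => ?_) fun z => ?_)
    · rw [abs_mul]
      exact mul_le_mul (hC _) (abs_stepDiff_le hc i z) (abs_nonneg _)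
        ((abs_nonneg _).trans (hC z.1))
    · have : g z.1 * stepDiff g i z + g (swapAt i z).1 * stepDiff g i (swapAt i z)
          = coordDiff g i z * stepDiff g i z := by
        rw [stepDiff_swapAt]; simp only [coordDiff, swapAt]; ring
      rw [this, abs_mul, sq]
      exact mul_le_mul (abs_coordDiff_le hc i z) (abs_stepDiff_le hc i z) (abs_nonneg _)
        ((abs_nonneg _).trans (abs_coordDiff_le hc i z))
  refine (Finset.sum_le_sum hterm).trans (le_of_eq ?_)
  simp

/-! ### The random Stein coefficient -/

lemma measurable_steinCoeff {g : (Fin n → 𝒳) → ℝ} (hg : Measurable g) :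
    Measurable (steinCoeff g) :=
  Finset.measurable_fun_sum _ fun i _ =>
    ((measurable_coordDiff hg i).mul (measurable_stepDiff hg i)).const_mul _

lemma exists_abs_comp_le {F : ℝ → ℝ} (hF : Continuous F) {α : Type*} {g : α → ℝ} {C : ℝ}
    (hC : ∀ x, |g x| ≤ C) : ∃ C', ∀ x, |F (g x)| ≤ C' := by
  obtain ⟨C', h⟩ := (isCompact_Icc (a := -C) (b := C)).exists_bound_of_continuousOn
    hF.continuousOn
  exact ⟨C', fun x => h _ (abs_le.1 (hC x))⟩

/-- The approximate integration by parts formula. After symmetrization each step of the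
interpolation contributes an error of the trapezoidal rule for `F`. -/
lemma abs_integral_comp_mul_sub_le {g : (Fin n → 𝒳) → ℝ} (hg : Measurable g) {C : ℝ}
    (hC : ∀ x, |g x| ≤ C) (hmean : ∫ x, g x ∂(Measure.pi ν) = 0) {a : ℝ}
    (ha : ∀ i y y' x, |partialDiff i y y' g x| ≤ a)
    {F F' : ℝ → ℝ} {L : ℝ} (hF : ∀ x, HasDerivAt F (F' x) x) (hF' : Continuous F')
    (hL0 : 0 ≤ L) (hL : ∀ x y, |F' x - F' y| ≤ L * |x - y|) :
    |(∫ x, F (g x) * g x ∂(Measure.pi ν)) -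
      ∫ z, F' (g z.1) * steinCoeff g z ∂((Measure.pi ν).prod (Measure.pi ν))|
      ≤ n * (L / 8 * a ^ 3) := by
  have hFc : Continuous F := continuous_iff_continuousAt.2 fun t => (hF t).continuousAt
  obtain ⟨K, hK⟩ := exists_abs_comp_le hFc hC
  obtain ⟨K', hK'⟩ := exists_abs_comp_le hF' hC
  have hFg : Measurable fun x => F (g x) := hFc.measurable.comp hg
  have hF'g : Measurable fun x => F' (g x) := hF'.measurable.comp hg
  have hcov := integral_mul_sub_eq_sum ν hFg hg hK hC
  rw [hmean, mul_zero, sub_zero] at hcov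
  set μ₂ := (Measure.pi ν).prod (Measure.pi ν) with hμ₂
  have hi1 : ∀ i, Integrable (fun z => F (g z.1) * stepDiff g i z) μ₂ := fun i =>
    integrable_of_abs_le (C := K * a) ((hFg.comp measurable_fst).mul (measurable_stepDiff hg i))
      fun z => by
        rw [abs_mul]
        exact mul_le_mul (hK _) (abs_stepDiff_le ha i z) (abs_nonneg _)
          ((abs_nonneg _).trans (hK z.1))
  have hi2 : ∀ i, Integrable
      (fun z => F' (g z.1) * (1 / 2 * (coordDiff g i z * stepDiff g i z))) μ₂ := fun i =>
    integrable_of_abs_le (C := K' * (a ^ 2 / 2)) ((hF'g.comp measurable_fst).mul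
      (((measurable_coordDiff hg i).mul (measurable_stepDiff hg i)).const_mul _)) fun z => by
        rw [abs_mul]
        exact mul_le_mul (hK' _) (abs_coordDiff_mul_stepDiff_le ha i z) (abs_nonneg _)
          ((abs_nonneg _).trans (hK' z.1))
  simp_rw [hcov, steinCoeff, Finset.mul_sum]
  rw [integral_finsetSum _ fun i _ => hi2 i, ← Finset.sum_sub_distrib]
  refine (Finset.abs_sum_le_sum_abs _ _).trans ((Finset.sum_le_sum
    (g := fun _ => L / 8 * a ^ 3) fun i _ => ?_).trans (le_of_eq ?_))
  · rw [← integral_sub (hi1 i) (hi2 i)]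
    refine (abs_integral_le_of_swapAt ν i (C := L / 4 * a ^ 3) (G := fun z =>
      F (g z.1) * stepDiff g i z
        - F' (g z.1) * (1 / 2 * (coordDiff g i z * stepDiff g i z))) ((hi1 i).sub (hi2 i))
      fun z => ?_).trans (le_of_eq (by ring))
    have hA := abs_coordDiff_le ha i z
    have hB := abs_stepDiff_le ha i z
    have ha0 : 0 ≤ a := (abs_nonneg _).trans hA
    have htr := SteinNormal.abs_trapezoid_le hF hL (g z.1) (g (swapAt i z).1)
    have hAdef : g z.1 - g (swapAt i z).1 = coordDiff g i z := rfl
    rw [hAdef] at htr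
    have hsum : (F (g z.1) * stepDiff g i z
          - F' (g z.1) * (1 / 2 * (coordDiff g i z * stepDiff g i z)))
        + (F (g (swapAt i z).1) * stepDiff g i (swapAt i z)
          - F' (g (swapAt i z).1) *
            (1 / 2 * (coordDiff g i (swapAt i z) * stepDiff g i (swapAt i z))))
        = stepDiff g i z * (F (g z.1) - F (g (swapAt i z).1)
          - coordDiff g i z * ((F' (g z.1) + F' (g (swapAt i z).1)) / 2)) := by
      rw [stepDiff_swapAt, coordDiff_swapAt]; ring
    rw [hsum, abs_mul]
    have hA2 : coordDiff g i z ^ 2 ≤ a ^ 2 := sq_le_sq' (abs_le.1 hA).1 (abs_le.1 hA).2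
    calc _ ≤ a * (L / 4 * a ^ 2) :=
          mul_le_mul hB (htr.trans (by gcongr)) (abs_nonneg _) ha0
      _ = _ := by ring
  · simp

/-- The conditional expectation of `steinCoeff g` given the first sample. -/
noncomputable def condSteinCoeff (g : (Fin n → 𝒳) → ℝ) (x : Fin n → 𝒳) : ℝ :=
  ∫ x', steinCoeff g (x, x') ∂(Measure.pi ν)

lemma measurable_condSteinCoeff {g : (Fin n → 𝒳) → ℝ} (hg : Measurable g) :
    Measurable (condSteinCoeff ν g) :=
  ((measurable_steinCoeff hg).stronglyMeasurable.integral_prod_right').measurable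

lemma abs_condSteinCoeff_le {g : (Fin n → 𝒳) → ℝ} {a : ℝ}
    (ha : ∀ i y y' x, |partialDiff i y y' g x| ≤ a) (x : Fin n → 𝒳) :
    |condSteinCoeff ν g x| ≤ n * (a ^ 2 / 2) :=
  abs_integral_le_of_abs_le fun x' => abs_steinCoeff_le ha (x, x')

lemma abs_mul_sub_mul_le {p q p' q' a d e : ℝ} (hq : |q| ≤ a) (hp' : |p'| ≤ a)
    (hd : |p - p'| ≤ d) (he : |q - q'| ≤ e) : |p * q - p' * q'| ≤ d * a + a * e := by
  have : p * q - p' * q' = (p - p') * q + p' * (q - q') := by ring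
  rw [this]
  refine (abs_add_le _ _).trans ?_
  rw [abs_mul, abs_mul]
  exact add_le_add (mul_le_mul hd hq (abs_nonneg _) ((abs_nonneg _).trans hd))
    (mul_le_mul hp' he (abs_nonneg _) ((abs_nonneg _).trans hp'))

/-- Changing the `i`-th coordinate changes the `i`-th summand of `steinCoeff g` by at most `a²`,
and each of the others by at most `a b`. -/
lemma abs_partialDiff_condSteinCoeff_le {g : (Fin n → 𝒳) → ℝ} (hg : Measurable g) {a b : ℝ}
    (hb0 : 0 ≤ b) (ha : ∀ i y y' x, |partialDiff i y y' g x| ≤ a)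
    (hb : ∀ i j, i ≠ j → ∀ y y' z z' x, |partialDiff i y y' (partialDiff j z z' g) x| ≤ b)
    (i : Fin n) (y y' : 𝒳) (x : Fin n → 𝒳) :
    |partialDiff i y y' (condSteinCoeff ν g) x| ≤ a * (n * b + a) := by
  have ha0 : 0 ≤ a := (abs_nonneg _).trans (ha i y y' x)
  have hint : ∀ x, Integrable (fun x' => steinCoeff g (x, x')) (Measure.pi ν) := fun x =>
    integrable_of_abs_le ((measurable_steinCoeff hg).comp measurable_prodMk_left)
      fun x' => abs_steinCoeff_le ha (x, x')
  rw [partialDiff, condSteinCoeff, condSteinCoeff, ← integral_sub (hint _) (hint _)]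
  have key : ∀ x', |steinCoeff g (Function.update x i y, x')
      - steinCoeff g (Function.update x i y', x')| ≤ a * (n * b + a) := by
    intro x'
    have hterm : ∀ j, |1 / 2 * (coordDiff g j (Function.update x i y, x')
          * stepDiff g j (Function.update x i y, x'))
        - 1 / 2 * (coordDiff g j (Function.update x i y', x')
          * stepDiff g j (Function.update x i y', x'))|
        ≤ a * b + if j = i then a * a else 0 := by
      intro j
      rw [← mul_sub, abs_mul, abs_of_pos (by norm_num : (0 : ℝ) < 1 / 2)]
      by_cases hj : j = i
      · subst hj
        have h1 : |coordDiff g j (Function.update x j y, x')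
            - coordDiff g j (Function.update x j y', x')| ≤ a := by
          have : coordDiff g j (Function.update x j y, x')
              - coordDiff g j (Function.update x j y', x') = partialDiff j y y' g x := by
            simp [coordDiff, partialDiff]
          rw [this]; exact ha _ _ _ _
        have h2 : |stepDiff g j (Function.update x j y, x')
            - stepDiff g j (Function.update x j y', x')| ≤ a := by
          have : stepDiff g j (Function.update x j y, x')
              - stepDiff g j (Function.update x j y', x')
              = partialDiff j y y' g (mix j x x') := by
            simp [stepDiff_eq_partialDiff, partialDiff, mix_update_of_le le_rfl]
          rw [this]; exact ha _ _ _ _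
        have := abs_mul_sub_mul_le (abs_stepDiff_le ha j (Function.update x j y, x'))
          (abs_coordDiff_le ha j (Function.update x j y', x')) h1 h2
        have hab : 0 ≤ a * b := mul_nonneg ha0 hb0
        simp only [if_true]
        linarith
      · have h1 : |coordDiff g j (Function.update x i y, x')
            - coordDiff g j (Function.update x i y', x')| ≤ b := by
          have : coordDiff g j (Function.update x i y, x')
              - coordDiff g j (Function.update x i y', x')
              = partialDiff i y y' (partialDiff j (x j) (x' j) g) x := by
            simp only [coordDiff_eq_partialDiff, Function.update_of_ne hj]
            rfl
          rw [this]; exact hb _ _ (Ne.symm hj) _ _ _ _ _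
        have h2 : |stepDiff g j (Function.update x i y, x')
            - stepDiff g j (Function.update x i y', x')| ≤ b := by
          rcases lt_or_ge i j with hij | hij
          · have : stepDiff g j (Function.update x i y, x')
                - stepDiff g j (Function.update x i y', x') = 0 := by
              simp [stepDiff_eq_partialDiff, Function.update_of_ne hj, mix_update_of_lt hij]
            rw [this, abs_zero]; exact hb0
          · have : stepDiff g j (Function.update x i y, x')
                - stepDiff g j (Function.update x i y', x')
                = partialDiff i y y' (partialDiff j (x j) (x' j) g) (mix j x x') := by
              simp only [stepDiff_eq_partialDiff, Function.update_of_ne hj, mix_update_of_le hij]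
              rfl
            rw [this]; exact hb _ _ (Ne.symm hj) _ _ _ _ _
        have := abs_mul_sub_mul_le (abs_stepDiff_le ha j (Function.update x i y, x'))
          (abs_coordDiff_le ha j (Function.update x i y', x')) h1 h2
        simp only [hj, if_false]
        linarith
    rw [steinCoeff, steinCoeff, ← Finset.sum_sub_distrib]
    refine (Finset.abs_sum_le_sum_abs _ _).trans ((Finset.sum_le_sum fun j _ =>
      hterm j).trans (le_of_eq ?_))
    rw [Finset.sum_add_distrib, Finset.sum_ite_eq' Finset.univ i]
    simp
    ring
  exact abs_integral_le_of_abs_le key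

/-! ### Normal approximation on the product space -/

lemma integral_mul_steinCoeff {g u : (Fin n → 𝒳) → ℝ} (hg : Measurable g) (hu : Measurable u)
    {a K : ℝ} (ha : ∀ i y y' x, |partialDiff i y y' g x| ≤ a) (hK : ∀ x, |u x| ≤ K) :
    ∫ z, u z.1 * steinCoeff g z ∂((Measure.pi ν).prod (Measure.pi ν))
      = ∫ x, u x * condSteinCoeff ν g x ∂(Measure.pi ν) := by
  rw [integral_prod]
  · simp_rw [integral_const_mul]; rfl
  · refine integrable_of_abs_le (C := K * (n * (a ^ 2 / 2)))
      ((hu.comp measurable_fst).mul (measurable_steinCoeff hg)) fun z => ?_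
    rw [abs_mul]
    exact mul_le_mul (hK _) (abs_steinCoeff_le ha z) (abs_nonneg _)
      ((abs_nonneg _).trans (hK z.1))

/-- The normal approximation bound for a centred function of unit variance. -/
theorem abs_integral_comp_sub_gaussian_le {g : (Fin n → 𝒳) → ℝ} (hg : Measurable g) {C : ℝ}
    (hC : ∀ x, |g x| ≤ C) (hmean : ∫ x, g x ∂(Measure.pi ν) = 0)
    (hvar : ∫ x, g x * g x ∂(Measure.pi ν) = 1) {a b : ℝ} (ha0 : 0 ≤ a) (hb0 : 0 ≤ b)
    (ha : ∀ i y y' x, |partialDiff i y y' g x| ≤ a)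
    (hb : ∀ i j, i ≠ j → ∀ y y' z z' x, |partialDiff i y y' (partialDiff j z z' g) x| ≤ b)
    {h : ℝ → ℝ} (hh : LipschitzWith 1 h) :
    |(∫ x, h (g x) ∂(Measure.pi ν)) - ∫ z, h z ∂(gaussianReal 0 1)|
      ≤ √(n : ℝ) * (a * (n * b + a)) + n * a ^ 3 / 2 := by
  obtain ⟨φ, H⟩ := SteinNormal.exists_isSteinSolution hh
  set m := ∫ z, h z ∂(gaussianReal 0 1) with hm
  set μ := Measure.pi ν with hμ
  set τ := condSteinCoeff ν g with hτ
  set ψ : ℝ → ℝ := fun x => x * φ x + (h x - m) with hψ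
  have hφc : Continuous φ := continuous_iff_continuousAt.2 fun t => (H.deriv t).continuousAt
  have hψc : Continuous ψ :=
    (continuous_id.mul hφc).add (hh.continuous.sub continuous_const)
  have hτm : Measurable τ := measurable_condSteinCoeff ν hg
  have hτb : ∀ x, |τ x| ≤ n * (a ^ 2 / 2) := abs_condSteinCoeff_le ν ha
  have hψm : Measurable fun x => ψ (g x) := hψc.measurable.comp hg
  have hψb : ∀ x, |ψ (g x)| ≤ √2 := fun x => H.abs_deriv_le_sqrt_two (g x)
  have hτi : Integrable τ μ := integrable_of_abs_le hτm hτb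
  have hττi : Integrable (fun x => τ x * τ x) μ := hτi.mul_bdd
    hτm.aestronglyMeasurable (ae_of_all _ hτb)
  have hψi : Integrable (fun x => ψ (g x)) μ := integrable_of_abs_le hψm hψb
  have hψτi : Integrable (fun x => ψ (g x) * τ x) μ := hψi.mul_bdd
    hτm.aestronglyMeasurable (ae_of_all _ hτb)
  obtain ⟨K, hK⟩ := exists_abs_comp_le hφc hC
  have hφgi : Integrable (fun x => φ (g x) * g x) μ :=
    (integrable_of_abs_le (hφc.measurable.comp hg) hK).mul_bdd
      hg.aestronglyMeasurable (ae_of_all _ hC)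
  have hhi : Integrable (fun x => h (g x)) μ := by
    obtain ⟨K', hK'⟩ := exists_abs_comp_le hh.continuous hC
    exact integrable_of_abs_le (hh.continuous.measurable.comp hg) hK'
  -- the formula is exact for the identity function, so `τ` has mean one
  have hτ1 : ∫ x, τ x ∂μ = 1 := by
    have h1 := abs_integral_comp_mul_sub_le ν hg hC hmean ha (F := fun x => x)
      (F' := fun _ => 1) (L := 0) (fun x => hasDerivAt_id x) continuous_const le_rfl (by simp)
    rw [integral_mul_steinCoeff ν hg measurable_const (u := fun _ => 1) (K := 1) ha (by simp),
      hvar] at h1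
    simp only [one_mul, zero_div, zero_mul, mul_zero] at h1
    linarith [abs_nonpos_iff.1 h1]
  have hmain := abs_integral_comp_mul_sub_le ν hg hC hmean ha H.deriv hψc (by norm_num)
    H.abs_deriv_sub_le
  rw [integral_mul_steinCoeff ν hg hψm ha hψb] at hmain
  -- by Stein's equation, `h (g x) - m = ψ (g x) - g x φ (g x)`
  have hstein : (∫ x, h (g x) ∂μ) - m
      = (∫ x, ψ (g x) * (1 - τ x) ∂μ)
        - ((∫ x, φ (g x) * g x ∂μ) - ∫ x, ψ (g x) * τ x ∂μ) := by
    have h1 : ∫ x, (h (g x) - m) ∂μ = (∫ x, h (g x) ∂μ) - m := by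
      rw [integral_sub hhi (integrable_const _)]; simp
    have h2 : ∫ x, (h (g x) - m) ∂μ = (∫ x, ψ (g x) ∂μ) - ∫ x, φ (g x) * g x ∂μ := by
      rw [← integral_sub hψi hφgi]
      refine integral_congr_ae (ae_of_all _ fun x => ?_)
      simp only [hψ]; ring
    have h3 : ∫ x, ψ (g x) * (1 - τ x) ∂μ = (∫ x, ψ (g x) ∂μ) - ∫ x, ψ (g x) * τ x ∂μ := by
      rw [← integral_sub hψi hψτi]
      exact integral_congr_ae (ae_of_all _ fun x => by ring)
    rw [← h1, h2, h3]; ring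
  set c := a * (n * b + a) with hc
  have hc0 : 0 ≤ c := by positivity
  have hvarτ : (∫ x, τ x * τ x ∂μ) - 1 ≤ n * (c ^ 2 / 2) := by
    have := variance_le_of_partialDiff ν hτm hτb
      (abs_partialDiff_condSteinCoeff_le ν hg hb0 ha hb)
    rwa [← hμ, hτ1, mul_one] at this
  -- `E |1 - τ| ≤ √(E (1 - τ)²)`, in the form that `|1 - τ|` has nonnegative variance
  have hCS : |∫ x, ψ (g x) * (1 - τ x) ∂μ| ≤ √(n : ℝ) * c := by
    have hb1 : Integrable (fun x => (1 - τ x) ^ 2) μ := by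
      have : (fun x => (1 - τ x) ^ 2) = fun x => (1 - 2 * τ x) + τ x * τ x := by
        funext x; ring
      rw [this]
      exact ((integrable_const _).sub (hτi.const_mul 2)).add hττi
    have hb2 : ∫ x, (1 - τ x) ^ 2 ∂μ ≤ n * (c ^ 2 / 2) := by
      have : ∀ x, (1 - τ x) ^ 2 = (1 - 2 * τ x) + τ x * τ x := fun x => by ring
      have h2τ : Integrable (fun x => 2 * τ x) μ := hτi.const_mul 2
      have h12 : Integrable (fun x => 1 - 2 * τ x) μ := (integrable_const _).sub h2τ
      simp_rw [this]
      rw [integral_add h12 hττi, integral_sub (integrable_const _) h2τ, integral_const_mul, hτ1]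
      simp only [integral_const, probReal_univ, one_smul]
      linarith
    have hb3 : (∫ x, |1 - τ x| ∂μ) ^ 2 ≤ ∫ x, (1 - τ x) ^ 2 ∂μ := by
      have habs : Integrable (fun x => |1 - τ x|) μ := ((integrable_const _).sub hτi).abs
      have h2 : MemLp (fun x => |1 - τ x|) 2 μ := by
        refine (memLp_two_iff_integrable_sq habs.aestronglyMeasurable).2 ?_
        simpa using hb1
      have := variance_eq_sub h2
      have h0 := variance_nonneg (fun x => |1 - τ x|) μ
      rw [this] at h0
      simp only [Pi.pow_apply, sq_abs] at h0
      linarith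
    have hb4 : |∫ x, ψ (g x) * (1 - τ x) ∂μ| ≤ √2 * ∫ x, |1 - τ x| ∂μ := by
      rw [← integral_const_mul]
      refine abs_integral_le_integral_abs.trans (integral_mono_of_nonneg
        (ae_of_all _ fun x => abs_nonneg _) (((integrable_const _).sub hτi).abs.const_mul _)
        (ae_of_all _ fun x => ?_))
      simp only [abs_mul]
      exact mul_le_mul_of_nonneg_right (hψb x) (abs_nonneg _)
    refine hb4.trans ?_
    refine abs_le_of_sq_le_sq' ?_ (by positivity) |>.2
    rw [mul_pow, mul_pow, Real.sq_sqrt (by norm_num), Real.sq_sqrt (Nat.cast_nonneg n)]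
    linarith
  rw [hstein]
  refine (abs_sub _ _).trans ?_
  have : (n : ℝ) * (4 / 8 * a ^ 3) = n * a ^ 3 / 2 := by ring
  linarith

end Measure

/-! ### The seminorms `M` and `J` -/

section Seminorms

variable {𝒳 : Type*} {n : ℕ} {f : (Fin n → 𝒳) → ℝ} {C : ℝ}

lemma partialDiff_swap (k : Fin n) (y y' : 𝒳) (f : (Fin n → 𝒳) → ℝ) (x : Fin n → 𝒳) :
    partialDiff k y y' f x = -partialDiff k y' y f x := by
  simp [partialDiff]

lemma abs_partialDiff_le_two_mul (hC : ∀ x, |f x| ≤ C) (k : Fin n) (y y' : 𝒳) (x : Fin n → 𝒳) :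
    |partialDiff k y y' f x| ≤ 2 * C :=
  (abs_sub _ _).trans (by linarith [hC (Function.update x k y), hC (Function.update x k y')])

lemma abs_partialDiff_le_M (hC : ∀ x, |f x| ≤ C) (k : Fin n) (y y' : 𝒳) (x : Fin n → 𝒳) :
    |partialDiff k y y' f x| ≤ M f := by
  have key : ∀ y y', partialDiff k y y' f x ≤ M f := fun y y' => by
    refine le_trans ?_ (le_ciSup (f := fun k : Fin n => sSup {r : ℝ | ∃ (x : Fin n → 𝒳)
      (y y' : 𝒳), r = partialDiff k y y' f x}) (Set.finite_range _).bddAbove k)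
    refine le_csSup ⟨2 * C, ?_⟩ ⟨x, y, y', rfl⟩
    rintro _ ⟨x, y, y', rfl⟩
    exact (le_abs_self _).trans (abs_partialDiff_le_two_mul hC k y y' x)
  refine abs_le.2 ⟨?_, key y y'⟩
  linarith [partialDiff_swap k y y' f x, key y' y]

lemma M_nonneg [Nonempty 𝒳] (hC : ∀ x, |f x| ≤ C) : 0 ≤ M f := by
  rcases isEmpty_or_nonempty (Fin n) with _ | ⟨⟨k⟩⟩
  · rw [M, Real.iSup_of_isEmpty]
  · obtain ⟨y⟩ := ‹Nonempty 𝒳›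
    exact (abs_nonneg _).trans (abs_partialDiff_le_M hC k y y fun _ => y)

/-- `J f` without its factor `n`: the maximum of all mixed second partial differences. -/
noncomputable def maxMixedDiff (f : (Fin n → 𝒳) → ℝ) : ℝ :=
  ⨆ p : {p : Fin n × Fin n // p.1 ≠ p.2},
    sSup {r : ℝ | ∃ (x : Fin n → 𝒳) (z z' y y' : 𝒳),
      r = partialDiff p.1.1 z z' (partialDiff p.1.2 y y' f) x}

lemma J_eq (f : (Fin n → 𝒳) → ℝ) : J f = n * maxMixedDiff f := rfl

lemma abs_partialDiff_partialDiff_le (hC : ∀ x, |f x| ≤ C) {l k : Fin n} (hlk : l ≠ k)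
    (z z' y y' : 𝒳) (x : Fin n → 𝒳) :
    |partialDiff l z z' (partialDiff k y y' f) x| ≤ maxMixedDiff f := by
  have key : ∀ z z', partialDiff l z z' (partialDiff k y y' f) x ≤ maxMixedDiff f :=
      fun z z' => by
    refine le_trans ?_ (le_ciSup (f := fun p : {p : Fin n × Fin n // p.1 ≠ p.2} =>
      sSup {r : ℝ | ∃ (x : Fin n → 𝒳) (z z' y y' : 𝒳),
        r = partialDiff p.1.1 z z' (partialDiff p.1.2 y y' f) x})
      (Set.finite_range _).bddAbove ⟨(l, k), hlk⟩)
    refine le_csSup ⟨2 * (2 * C), ?_⟩ ⟨x, z, z', y, y', rfl⟩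
    rintro _ ⟨x, z, z', y, y', rfl⟩
    exact (le_abs_self _).trans
      (abs_partialDiff_le_two_mul (abs_partialDiff_le_two_mul hC k y y') l z z' x)
  refine abs_le.2 ⟨?_, key z z'⟩
  linarith [partialDiff_swap l z z' (partialDiff k y y' f) x, key z' z]

lemma maxMixedDiff_nonneg [Nonempty 𝒳] (hC : ∀ x, |f x| ≤ C) : 0 ≤ maxMixedDiff f := by
  rcases isEmpty_or_nonempty {p : Fin n × Fin n // p.1 ≠ p.2} with _ | ⟨⟨p⟩⟩
  · rw [maxMixedDiff, Real.iSup_of_isEmpty]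
  · obtain ⟨y⟩ := ‹Nonempty 𝒳›
    exact (abs_nonneg _).trans (abs_partialDiff_partialDiff_le hC p.2 y y y y fun _ => y)

lemma partialDiff_sub_const (c : ℝ) (k : Fin n) (y y' : 𝒳) (f : (Fin n → 𝒳) → ℝ) :
    partialDiff k y y' (fun x => f x - c) = partialDiff k y y' f := by
  funext x
  simp [partialDiff]

lemma partialDiff_div_const (c : ℝ) (k : Fin n) (y y' : 𝒳) (f : (Fin n → 𝒳) → ℝ) :
    partialDiff k y y' (fun x => f x / c) = fun x => partialDiff k y y' f x / c := by
  funext x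
  simp only [partialDiff]
  ring

end Seminorms

end WeakInteraction

open WeakInteraction

theorem theorem3 {Ω : Type*} [MeasurableSpace Ω] (P : Measure Ω) [IsProbabilityMeasure P]
    {𝒳 : Type*} [MeasurableSpace 𝒳] (n : ℕ)
    (X : Fin n → Ω → 𝒳) (hX : ∀ k, Measurable (X k)) (hindep : iIndepFun X P)
    (f : (Fin n → 𝒳) → ℝ) (hf : Measurable f) (hbdd : ∃ C : ℝ, ∀ x, |f x| ≤ C)
    (hvar : 0 < variance (fun ω => f (fun k => X k ω)) P) :
    WeakInteraction.distNormal P (fun ω => f (fun k => X k ω)) ≤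
      ENNReal.ofReal
        (√(n : ℝ) * WeakInteraction.M f * (WeakInteraction.J f + WeakInteraction.M f)
            / variance (fun ω => f (fun k => X k ω)) P
          + n * WeakInteraction.M f ^ 3
            / (2 * √(variance (fun ω => f (fun k => X k ω)) P) ^ 3)) := by
  obtain ⟨C, hC⟩ := hbdd
  set W : Ω → ℝ := fun ω => f (fun k => X k ω) with hW
  set m := ∫ ω, W ω ∂P with hm
  set s := √(variance W P) with hs
  have hs0 : 0 < s := Real.sqrt_pos.2 hvar
  have hs2 : s ^ 2 = variance W P := Real.sq_sqrt hvar.le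
  set ν : Fin n → Measure 𝒳 := fun k => P.map (X k) with hν
  have : ∀ k, IsProbabilityMeasure (ν k) := fun k =>
    Measure.isProbabilityMeasure_map (hX k).aemeasurable
  have hXm : Measurable fun ω k => X k ω := measurable_pi_iff.2 hX
  have hmap : P.map (fun ω k => X k ω) = Measure.pi ν :=
    (iIndepFun_iff_map_fun_eq_pi_map fun k => (hX k).aemeasurable).1 hindep
  have htrans : ∀ {u : (Fin n → 𝒳) → ℝ}, Measurable u →
      ∫ x, u x ∂(Measure.pi ν) = ∫ ω, u (fun k => X k ω) ∂P := fun {u} hu => by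
    rw [← hmap, integral_map hXm.aemeasurable hu.aestronglyMeasurable]
  set g : (Fin n → 𝒳) → ℝ := fun x => (f x - m) / s with hg
  have hgm : Measurable g := (hf.sub_const m).div_const s
  have hgC : ∀ x, |g x| ≤ (C + |m|) / s := fun x => by
    rw [hg, abs_div, abs_of_pos hs0]
    gcongr
    exact (abs_sub _ _).trans (add_le_add (hC x) le_rfl)
  have hWm : Measurable W := hf.comp hXm
  have hWi : Integrable W P := integrable_of_abs_le hWm fun ω => hC _
  have hmean : ∫ x, g x ∂(Measure.pi ν) = 0 := by
    rw [htrans hgm, hg, integral_div, integral_sub hWi (integrable_const _)]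
    simp [hm]
  have hsecond : ∫ x, g x * g x ∂(Measure.pi ν) = 1 := by
    rw [htrans (u := fun x => g x * g x) (hgm.mul hgm)]
    have h1 : ∀ ω, g (fun k => X k ω) * g (fun k => X k ω) = (W ω - m) ^ 2 / s ^ 2 := fun ω => by
      simp only [hg, hW]; ring
    simp_rw [h1]
    rw [integral_div, ← variance_eq_integral hWm.aemeasurable, hs2, div_self hvar.ne']
  have ha : ∀ i y y' x, |partialDiff i y y' g x| ≤ M f / s := fun i y y' x => by
    rw [hg, partialDiff_div_const, partialDiff_sub_const, abs_div, abs_of_pos hs0]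
    gcongr
    exact abs_partialDiff_le_M hC _ _ _ _
  have hb : ∀ i j, i ≠ j → ∀ y y' z z' x,
      |partialDiff i y y' (partialDiff j z z' g) x| ≤ maxMixedDiff f / s :=
    fun i j hij y y' z z' x => by
      rw [hg, partialDiff_div_const, partialDiff_sub_const, partialDiff_div_const, abs_div,
        abs_of_pos hs0]
      gcongr
      exact abs_partialDiff_partialDiff_le hC hij _ _ _ _ _
  -- a positive variance excludes `n = 0`, the only case in which `𝒳` can be empty
  have hne : Nonempty 𝒳 := by
    rcases Nat.eq_zero_or_pos n with hn | hn
    · subst hn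
      have : W = fun _ => f (fun k => k.elim0) := by
        funext ω; simp only [hW]; congr 1; funext k; exact k.elim0
      rw [this] at hvar
      simp [variance, evariance] at hvar
    · obtain ⟨ω⟩ := nonempty_of_isProbabilityMeasure P
      exact ⟨X ⟨0, hn⟩ ω⟩
  refine iSup₂_le fun h hh => ENNReal.ofReal_le_ofReal ?_
  have hmain := abs_integral_comp_sub_gaussian_le ν hgm hgC hmean hsecond
    (div_nonneg (M_nonneg hC) hs0.le) (div_nonneg (maxMixedDiff_nonneg hC) hs0.le) ha hb hh
  rw [htrans (u := fun x => h (g x)) (hh.continuous.measurable.comp hgm)] at hmain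
  refine hmain.trans (le_of_eq ?_)
  rw [J_eq, ← hs2]
  field_simp
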